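/- **Setting.** Terms are built over a finite signature $\Sigma$ and an infinite set $\mathcal V$ of variables. A *finite multi-distribution* on a set $A$ is a finite multiset of pairs $(p:a)$ with $0<p\le 1$ and $a\in A$ whose probabilities add up to $1$. A *PTRS* $\mathcal P$ is a finite set of rules $\ell\to\{p_1:r_1,\dots,p_k:r_k\}$, where the right-hand side is a finite multi-distribution on terms, $\ell$ is a term that is not a variable, and every variable of each $r_j$ occurs in $\ell$. It induces the steps $s\to_{\mathcal P}\{p_1:s[r_1\sigma]_\pi,\dots,p_k:s[r_k\sigma]_\pi\}$ for every such rule, every position $\pi$ of $s$ and every substitution $\sigma$ (with finite domain) such that $s|_\pi=\ell\sigma$. A *$\mathcal P$-rewrite-sequence-tree* ($\mathcal P$-RST) is a possibly infinite, finitely branching rooted tree $\mathfrak T$ whose nodes $v$ are labeled by a probability $p_v\in(0,1]$ and a term $t_v$, where the root has probability $1$ and each node $v$ with children $w_1,\dots,w_k$, $k\ge 1$, satisfies $t_v\to_{\mathcal P}\{\tfrac{p_{w_1}}{p_v}:t_{w_1},\dots,\tfrac{p_{w_k}}{p_v}:t_{w_k}\}$. (A leaf need not be labeled by a normal form.) Let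 $d(v)$ be the depth of the node $v$; the height of $\mathfrak T$ is the supremum of the depths of its nodes. Let $|\mathfrak T|=\sum_{v\in\mathrm{Leaf}(\mathfrak T)}p_v$, and let $\mathrm{edl}(\mathfrak T)=\infty$ if $|\mathfrak T|<1$ and $\mathrm{edl}(\mathfrak T)=\sum_{v\in\mathrm{Leaf}(\mathfrak T)}d(v)\cdot p_v\in[0,\infty]$ otherwise. $\mathcal P$ is *AST* if $|\mathfrak T|=1$ for all $\mathcal P$-RSTs $\mathfrak T$, and *PAST* if $\mathrm{edl}(\mathfrak T)<\infty$ for all $\mathcal P$-RSTs $\mathfrak T$. A term $t$ *occurs* in $s$ at a position $\pi$ of $s$ if $s|_\pi=t\sigma$ for some substitution $\sigma$. Two positions $\pi_1,\pi_2$ *overlap* w.r.t. $t$ if $\pi_1=\pi_2.\tau$ or $\pi_2=\pi_1.\tau$ for some position $\tau$ of $t$ at which $t$ has a function symbol. Let $\mathrm{maxNO}(t,s)$ be the maximal cardinality of a set $S$ of positions of $s$ such that $t$ occurs in $s$ at every $\pi\in S$ and no two distinct elements of $S$ overlap w.r.t. $t$. A term is *linear* if each variable occurs at most once in it. **Theorem.**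 Let $\mathcal P$ be a PTRS and let $\mathfrak T$ be a (possibly infinite) $\mathcal P$-RST of positive height whose root is labeled by a linear term $t$. 1. If $\sum_{v\in\mathrm{Leaf}(\mathfrak T)}p_v\cdot\mathrm{maxNO}(t,t_v)>1$, then $\mathcal P$ is not AST. 2. If $\sum_{v\in\mathrm{Leaf}(\mathfrak T)}p_v\cdot\mathrm{maxNO}(t,t_v)\ge 1$, then $\mathcal P$ is not PAST. (The sum is taken in $[0,\infty]$.) -/

import Mathlib

open scoped NNReal ENNReal

namespace ProbRewriting

/-! ### Multi-distributions, probabilistic abstract reduction systems, rewrite sequence trees -/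

/-- A finite multi-distribution on `A`: a finite multiset of pairs `(p : a)` with `0 < p ≤ 1`
whose probabilities sum up to `1`. -/
structure FDist (A : Type*) where
  entries : Multiset (ℝ≥0 × A)
  prob_pos : ∀ q ∈ entries, 0 < q.1
  prob_le_one : ∀ q ∈ entries, q.1 ≤ 1
  prob_sum : (entries.map Prod.fst).sum = 1

/-- A probabilistic abstract reduction system on `A`. -/
abbrev PARS (A : Type*) := A → FDist A → Prop

/-- A (possibly infinite) rewrite sequence tree of a PARS.  The nodes are given by their addresses:
`[]` is the root and `v ++ [0], …, v ++ [k - 1]` are the children of a node `v`, where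
`k = numChildren v`.  Every node `v` carries a probability and an object, and whenever `v` has
children `w₁, …, w_k` with `k ≥ 1`, then `a_v → {p_{w₁} / p_v : a_{w₁}, …, p_{w_k} / p_v : a_{w_k}}`
is a step of the PARS.  The values of the functions at addresses outside `nodes` are irrelevant. -/
structure RST {A : Type*} (R : PARS A) where
  nodes : Set (List ℕ)
  numChildren : List ℕ → ℕ
  prob : List ℕ → ℝ≥0
  obj : List ℕ → A
  root_mem : [] ∈ nodes
  child_mem_iff : ∀ v i, v ++ [i] ∈ nodes ↔ v ∈ nodes ∧ i < numChildren v
  prob_root : prob [] = 1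
  prob_pos : ∀ v ∈ nodes, 0 < prob v
  prob_le_one : ∀ v ∈ nodes, prob v ≤ 1
  step : ∀ v ∈ nodes, 0 < numChildren v → ∃ μ : FDist A, R (obj v) μ ∧
    μ.entries = (Multiset.range (numChildren v)).map
      (fun i => (prob (v ++ [i]) / prob v, obj (v ++ [i])))

namespace RST

variable {A : Type*} {R : PARS A}

/-- The object at the root. -/
def root (T : RST R) : A := T.obj []

/-- The set of leaves. -/
def leaves (T : RST R) : Set (List ℕ) := {v | v ∈ T.nodes ∧ T.numChildren v = 0}

/-- The depth of a node is the length of its address. -/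
def depth (_T : RST R) (v : List ℕ) : ℕ := v.length

/-- The height: the supremum of the depths of the nodes (`⊤` if they are unbounded). -/
noncomputable def height (T : RST R) : ℕ∞ := ⨆ v ∈ T.nodes, (T.depth v : ℕ∞)

/-- The termination probability `|T| = ∑_{v ∈ Leaf(T)} p_v`. -/
noncomputable def terminationProb (T : RST R) : ℝ≥0∞ := ∑' v : T.leaves, (T.prob v : ℝ≥0∞)

open Classical in
/-- The expected derivation length: `∞` if `|T| < 1`, and `∑_{v ∈ Leaf(T)} d(v) · p_v` otherwise. -/
noncomputable def edl (T : RST R) : ℝ≥0∞ :=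
  if T.terminationProb < 1 then ⊤
  else ∑' v : T.leaves, (T.depth v : ℝ≥0∞) * (T.prob v : ℝ≥0∞)

end RST

/-- Almost-sure termination of a PARS. -/
def IsAST {A : Type*} (R : PARS A) : Prop := ∀ T : RST R, T.terminationProb = 1

/-- Positive almost-sure termination of a PARS. -/
def IsPAST {A : Type*} (R : PARS A) : Prop := ∀ T : RST R, T.edl < ⊤

/-! ### Terms, positions, substitutions

Terms over a signature are the first-order terms of Mathlib; relation symbols of `L` play no role.
Positions are lists of natural numbers, where arguments are counted from `0`. -/

section Terms

variable {L : FirstOrder.Language} {V : Type*}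

/-- The subterm `t|_π`, which is `none` if `π` is not a position of `t`. -/
def subtermAt : L.Term V → List ℕ → Option (L.Term V)
  | t, [] => some t
  | .var _, _ :: _ => none
  | .func (l := n) _ ts, i :: π => if h : i < n then subtermAt (ts ⟨i, h⟩) π else none

/-- The term `t[r]_π` (only used for positions `π` of `t`). -/
def replaceAt : L.Term V → List ℕ → L.Term V → L.Term V
  | _, [], r => r
  | .var x, _ :: _, _ => .var x
  | .func f ts, i :: π, r =>
      .func f (fun j => if (j : ℕ) = i then replaceAt (ts j) π r else ts j)

/-- The set of positions of a term. -/
def Pos (t : L.Term V) : Set (List ℕ) := {π | ∃ s, subtermAt t π = some s}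

/-- The set of positions of a term that carry a function symbol. -/
def PosFun (t : L.Term V) : Set (List ℕ) :=
  {π | ∃ (n : ℕ) (f : L.Functions n) (ts : Fin n → L.Term V),
    subtermAt t π = some (FirstOrder.Language.Term.func f ts)}

/-- A substitution: a map from variables to terms with finite domain. -/
structure Subst (L : FirstOrder.Language) (V : Type*) where
  toFun : V → L.Term V
  finite_dom : {x | toFun x ≠ FirstOrder.Language.Term.var x}.Finite

/-- The homomorphic extension `tσ` of a substitution to terms. -/
def Subst.apply (σ : Subst L V) (t : L.Term V) : L.Term V := t.subst σ.toFun

/-- A term is linear if every variable occurs at most once in it. -/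
def IsLinear (t : L.Term V) : Prop :=
  ∀ x : V, {π | subtermAt t π = some (FirstOrder.Language.Term.var x)}.encard ≤ 1

/-! ### Occurrences -/

/-- `t` occurs in `s` at position `π`. -/
def OccursAt (t s : L.Term V) (π : List ℕ) : Prop :=
  ∃ σ : Subst L V, subtermAt s π = some (σ.apply t)

/-- The positions `π₁` and `π₂` are overlapping w.r.t. `t`. -/
def Overlapping (t : L.Term V) (π₁ π₂ : List ℕ) : Prop :=
  ∃ τ ∈ PosFun t, π₁ = π₂ ++ τ ∨ π₂ = π₁ ++ τ

/-- The set of all sets of pairwise non-overlapping occurrences of `t` in `s`. -/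
def NO (t s : L.Term V) : Set (Finset (List ℕ)) :=
  {S | (∀ π ∈ S, π ∈ Pos s) ∧ (∀ π ∈ S, OccursAt t s π) ∧
    ∀ π₁ ∈ S, ∀ π₂ ∈ S, π₁ ≠ π₂ → ¬ Overlapping t π₁ π₂}

/-- The maximal cardinality of a set of pairwise non-overlapping occurrences of `t` in `s`. -/
noncomputable def maxNO (t s : L.Term V) : ℕ := sSup (Finset.card '' NO t s)

theorem finite_pos (t : L.Term V) : (Pos t).Finite := by
  induction t with
  | var x =>
    refine (Set.finite_singleton ([] : List ℕ)).subset ?_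
    rintro (_ | ⟨i, π⟩) ⟨s, hs⟩
    · rfl
    · simp [subtermAt] at hs
  | func f ts ih =>
    refine ((Set.finite_singleton ([] : List ℕ)).union
      (Set.finite_iUnion fun j => (ih j).image (List.cons (j : ℕ)))).subset ?_
    rintro (_ | ⟨i, π⟩) ⟨s, hs⟩
    · exact Or.inl rfl
    · right
      simp only [subtermAt] at hs
      split_ifs at hs with h
      exact Set.mem_iUnion.2 ⟨⟨i, h⟩, π, ⟨s, hs⟩, rfl⟩

/-- The supremum in the definition of `maxNO` is a maximum. -/
theorem isGreatest_maxNO (t s : L.Term V) : IsGreatest (Finset.card '' NO t s) (maxNO t s) := by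
  have hne : (Finset.card '' NO t s).Nonempty := ⟨0, ∅, by simp [NO], rfl⟩
  have hb : BddAbove (Finset.card '' NO t s) := by
    refine ⟨(finite_pos s).toFinset.card, ?_⟩
    rintro _ ⟨S, hS, rfl⟩
    exact Finset.card_le_card fun π hπ => (finite_pos s).mem_toFinset.2 (hS.1 π hπ)
  exact ⟨Nat.sSup_mem hne hb, fun k hk => le_csSup hb hk⟩

end Terms

/-! ### Probabilistic term rewriting -/

open Classical in
/-- A probabilistic term rewrite rule `ℓ → μ`: `ℓ` is not a variable, and all variables of the terms
in the support of `μ` occur in `ℓ`. -/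
structure Rule (L : FirstOrder.Language) (V : Type*) where
  lhs : L.Term V
  rhs : FDist (L.Term V)
  lhs_ne_var : ∀ x : V, lhs ≠ FirstOrder.Language.Term.var x
  vars_subset : ∀ q ∈ rhs.entries, q.2.varFinset ⊆ lhs.varFinset

/-- A probabilistic term rewrite system: a finite set of probabilistic term rewrite rules. -/
structure PTRS (L : FirstOrder.Language) (V : Type*) where
  rules : Set (Rule L V)
  finite_rules : rules.Finite

namespace PTRS

variable {L : FirstOrder.Language} {V : Type*}

/-- The PARS on terms induced by a PTRS: `s → {p₁ : s[r₁σ]_π, …, p_k : s[r_kσ]_π}` for a rule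
`ℓ → {p₁ : r₁, …, p_k : r_k}` and a position `π` of `s` with `s|_π = ℓσ`. -/
def Step (P : PTRS L V) : PARS (L.Term V) := fun s μ =>
  ∃ ρ ∈ P.rules, ∃ (π : List ℕ) (σ : Subst L V),
    subtermAt s π = some (σ.apply ρ.lhs) ∧
    μ.entries = ρ.rhs.entries.map (fun q => (q.1, replaceAt s π (σ.apply q.2)))

end PTRS

end ProbRewriting

/-! ### Optional stopping in rewrite sequence trees -/

namespace ProbRewriting

/-! Run `T` again and again: whenever a copy of it reaches a leaf `v`, the `maxNO t (T.obj v)`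
non-overlapping occurrences of `t` found there become pending, and the next copy starts at one
pending occurrence. The number of pending runs behaves like a branching process whose offspring
number `X` has the sum in the theorem as its expected value.

That the copies do not disturb each other is expressed by `Focused`. The active copy works at a
position with no pending occurrence at or below it, and overlapping none. A pending occurrence is
therefore parallel to the active position, or has it below one of the variables of `t`; since `t` is
linear, such an occurrence survives every step. Restarting at a deepest pending occurrence
(`Focused.restart`) keeps the invariant, and `exists_repeat` assembles the resulting tree `T'`.

Let `f ρ` be the expected value of `ρ ^ X`. The conditional expectation of `ρ` to the number of runs
pending at the end of the current copy is preserved by the steps inside a copy, and changes at a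
restart from `ρ ^ (k + 1)` to `ρ ^ k * f ρ`. If `f ρ ≤ ρ + δ`, optional stopping bounds the
termination probability of `T'` by `f ρ + δ * D`, where `D` is the expected number of steps.

If `X` has expected value above `1`, some `ρ < 1` has `f ρ ≤ ρ`, and `δ = 0` gives termination
probability below `1`. If it is at least `1`, then `f ρ ≤ ρ + d * (1 - ρ)` for arbitrarily small `d
> 0` and a suitable `ρ < 1` depending on `d`; a finite `D` is refuted by taking `d` small compared
to `1 / D`. -/

theorem tsum_list_cons (G : List ℕ → ℝ≥0∞) :
    ∑' u, G u = G [] + ∑' i, ∑' u, G (i :: u) := by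
  let e : Unit ⊕ ℕ × List ℕ ≃ List ℕ :=
    { toFun := Sum.elim (fun _ => []) fun q => q.1 :: q.2
      invFun := fun l => match l with
        | [] => .inl ()
        | i :: u => .inr (i, u)
      left_inv := by rintro (_ | ⟨i, u⟩) <;> rfl
      right_inv := by rintro (_ | ⟨i, u⟩) <;> rfl }
  rw [← e.tsum_eq, Summable.tsum_sum ENNReal.summable ENNReal.summable, ENNReal.tsum_prod']
  simp [e]

/-- Reversal of addresses turns splitting off the first entry into splitting off the last one, which
is how children are addressed. -/
theorem tsum_list_concat (G : List ℕ → ℝ≥0∞) :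
    ∑' u, G u = G [] + ∑' u, ∑' i, G (u ++ [i]) := by
  have hr : Function.Involutive (List.reverse : List ℕ → List ℕ) := List.reverse_reverse
  have h := (hr.toPerm _).tsum_eq G
  rw [← h, tsum_list_cons, ENNReal.tsum_comm, ← (hr.toPerm _).tsum_eq]
  simp [Function.Involutive.toPerm]

/-- The sum of `G` over all addresses of length `n`. -/
noncomputable def levelSum (G : List ℕ → ℝ≥0∞) (n : ℕ) : ℝ≥0∞ :=
  ∑' v : List ℕ, if v.length = n then G v else 0

theorem levelSum_zero (G : List ℕ → ℝ≥0∞) : levelSum G 0 = G [] := by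
  rw [levelSum, tsum_list_cons]
  simp

theorem levelSum_succ (G : List ℕ → ℝ≥0∞) (n : ℕ) :
    levelSum G (n + 1) = levelSum (fun v => ∑' i, G (v ++ [i])) n := by
  rw [levelSum, tsum_list_concat, levelSum]
  simp only [List.length_nil, List.length_append, List.length_singleton, add_left_inj]
  rw [if_neg (by omega), zero_add]
  refine tsum_congr fun v => ?_
  split_ifs <;> simp

theorem levelSum_mono {G H : List ℕ → ℝ≥0∞} (h : ∀ v, G v ≤ H v) (n : ℕ) :
    levelSum G n ≤ levelSum H n :=
  ENNReal.tsum_le_tsum fun v => by split_ifs <;> simp [h]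

theorem levelSum_add (G H : List ℕ → ℝ≥0∞) (n : ℕ) :
    levelSum (fun v => G v + H v) n = levelSum G n + levelSum H n := by
  rw [levelSum, levelSum, levelSum, ← ENNReal.tsum_add]
  refine tsum_congr fun v => ?_
  split_ifs <;> simp

theorem levelSum_mul_left (c : ℝ≥0∞) (G : List ℕ → ℝ≥0∞) (n : ℕ) :
    levelSum (fun v => c * G v) n = c * levelSum G n := by
  rw [levelSum, levelSum, ← ENNReal.tsum_mul_left]
  simp only [mul_ite, mul_zero]

theorem levelSum_length_mul (G : List ℕ → ℝ≥0∞) (n : ℕ) :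
    levelSum (fun v => (v.length : ℝ≥0∞) * G v) n = n * levelSum G n := by
  rw [← levelSum_mul_left, levelSum, levelSum]
  refine tsum_congr fun v => ?_
  split_ifs with h <;> simp [h]

theorem tsum_levelSum (G : List ℕ → ℝ≥0∞) : ∑' n, levelSum G n = ∑' v, G v := by
  simp only [levelSum]
  rw [ENNReal.tsum_comm]
  refine tsum_congr fun v => ?_
  simp only [eq_comm (a := v.length)]
  rw [tsum_ite_eq]

/-! ### Mass balance and expected derivation length of a tree -/

namespace RST

variable {A : Type*} {R : PARS A} (T : RST R)

theorem sum_prob_children {v : List ℕ} (hv : v ∈ T.nodes) (hc : 0 < T.numChildren v) :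
    ∑ i ∈ Finset.range (T.numChildren v), T.prob (v ++ [i]) = T.prob v := by
  obtain ⟨μ, -, hμ⟩ := T.step v hv hc
  have h := μ.prob_sum
  rw [hμ, Multiset.map_map] at h
  have h' : ∑ i ∈ Finset.range (T.numChildren v), T.prob (v ++ [i]) / T.prob v = 1 := h
  rwa [← Finset.sum_div, div_eq_one_iff_eq (T.prob_pos v hv).ne'] at h'

/-- The probabilities of the nodes, extended by zero. -/
noncomputable def nodeProb : List ℕ → ℝ≥0∞ := T.nodes.indicator fun v => (T.prob v : ℝ≥0∞)

/-- The probabilities of the leaves, extended by zero. -/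
noncomputable def leafProb : List ℕ → ℝ≥0∞ := T.leaves.indicator fun v => (T.prob v : ℝ≥0∞)

theorem terminationProb_eq : T.terminationProb = ∑' v, T.leafProb v :=
  tsum_subtype T.leaves fun v => (T.prob v : ℝ≥0∞)

theorem tsum_indicator_children (F : List ℕ → ℝ≥0∞) {v : List ℕ} (hv : v ∈ T.nodes) :
    ∑' i, T.nodes.indicator F (v ++ [i]) =
      ∑ i ∈ Finset.range (T.numChildren v), F (v ++ [i]) := by
  rw [tsum_eq_sum (s := Finset.range (T.numChildren v))]
  · refine Finset.sum_congr rfl fun i hi => Set.indicator_of_mem ?_ _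
    exact (T.child_mem_iff v i).2 ⟨hv, Finset.mem_range.1 hi⟩
  · intro i hi
    refine Set.indicator_of_notMem (fun h => hi ?_) _
    exact Finset.mem_range.2 ((T.child_mem_iff v i).1 h).2

theorem tsum_indicator_children_of_notMem (F : List ℕ → ℝ≥0∞) {v : List ℕ} (hv : v ∉ T.nodes) :
    ∑' i, T.nodes.indicator F (v ++ [i]) = 0 := by
  refine ENNReal.tsum_eq_zero.2 fun i => Set.indicator_of_notMem (fun h => hv ?_) _
  exact ((T.child_mem_iff v i).1 h).1

/-- Mass is conserved: a leaf keeps its probability, an inner node passes it on to its children.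
Extension by zero gives this one form at every address. -/
theorem nodeProb_eq (v : List ℕ) :
    T.nodeProb v = T.leafProb v + ∑' i, T.nodeProb (v ++ [i]) := by
  by_cases hv : v ∈ T.nodes
  · rw [nodeProb, T.tsum_indicator_children _ hv, Set.indicator_of_mem hv, leafProb]
    rcases Nat.eq_zero_or_pos (T.numChildren v) with hc | hc
    · rw [Set.indicator_of_mem (show v ∈ T.leaves from ⟨hv, hc⟩), hc]
      simp
    · rw [Set.indicator_of_notMem (fun h => hc.ne' h.2), zero_add, ← T.sum_prob_children hv hc]
      push_cast
      rfl
  · rw [nodeProb, T.tsum_indicator_children_of_notMem _ hv, Set.indicator_of_notMem hv, leafProb,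
      Set.indicator_of_notMem (fun h => hv h.1), add_zero]

theorem nil_nodeProb : T.nodeProb [] = 1 := by
  rw [nodeProb, Set.indicator_of_mem T.root_mem, T.prob_root, ENNReal.coe_one]

theorem levelSum_nodeProb (n : ℕ) :
    levelSum T.nodeProb n = levelSum T.leafProb n + levelSum T.nodeProb (n + 1) := by
  rw [levelSum_succ, ← levelSum_add]
  exact congrArg (levelSum · n) (funext T.nodeProb_eq)

theorem sum_levelSum_leafProb (n : ℕ) :
    ∑ k ∈ Finset.range n, levelSum T.leafProb k + levelSum T.nodeProb n = 1 := by
  induction n with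
  | zero => simp [levelSum_zero, nil_nodeProb]
  | succ n ih => rw [Finset.sum_range_succ, add_assoc, ← levelSum_nodeProb, ih]

theorem terminationProb_le_one : T.terminationProb ≤ 1 := by
  rw [terminationProb_eq, ← tsum_levelSum]
  refine ENNReal.tsum_le_of_sum_range_le fun n => ?_
  rw [← T.sum_levelSum_leafProb n]
  exact le_self_add

/-- This is the tail-sum formula for the expected depth of a leaf. Termination probability `1` is
needed so that the mass on level `m + 1` is exactly the mass of the leaves deeper than `m`. -/
theorem tsum_levelSum_nodeProb (h : T.terminationProb = 1) :
    ∑' n, levelSum T.nodeProb (n + 1) =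
      ∑' v : T.leaves, (T.depth v : ℝ≥0∞) * (T.prob v : ℝ≥0∞) := by
  have h1 (m : ℕ) : levelSum T.nodeProb (m + 1) =
      ∑' n, if m < n then levelSum T.leafProb n else 0 := by
    have h2 := T.sum_levelSum_leafProb (m + 1)
    have hfin : ∑ k ∈ Finset.range (m + 1), levelSum T.leafProb k ≠ ⊤ :=
      ne_top_of_le_ne_top ENNReal.one_ne_top (h2 ▸ le_self_add)
    refine (ENNReal.add_right_inj hfin).1 ?_
    rw [h2, ← h, terminationProb_eq, ← tsum_levelSum]
    have h3 : ∑ k ∈ Finset.range (m + 1), levelSum T.leafProb k =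
        ∑' n, if n < m + 1 then levelSum T.leafProb n else 0 := by
      rw [tsum_eq_sum (s := Finset.range (m + 1))]
      · exact Finset.sum_congr rfl fun k hk => (if_pos (Finset.mem_range.1 hk)).symm
      · exact fun k hk => if_neg fun hk' => hk (Finset.mem_range.2 hk')
    rw [h3, ← ENNReal.tsum_add]
    refine tsum_congr fun n => ?_
    rcases lt_or_ge m n with hn | hn
    · rw [if_pos hn, if_neg fun h => hn.not_ge (Nat.le_of_lt_succ h), zero_add]
    · rw [if_pos (Nat.lt_succ_of_le hn), if_neg hn.not_gt, add_zero]
  simp only [h1]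
  rw [ENNReal.tsum_comm, tsum_subtype T.leaves fun v => (T.depth v : ℝ≥0∞) * (T.prob v : ℝ≥0∞)]
  have h4 : (T.leaves.indicator fun v => (T.depth v : ℝ≥0∞) * (T.prob v : ℝ≥0∞)) =
      fun v => (v.length : ℝ≥0∞) * T.leafProb v := by
    funext v
    exact Set.indicator_mul_right _ _ _
  rw [h4, ← tsum_levelSum]
  refine tsum_congr fun n => ?_
  rw [levelSum_length_mul, tsum_eq_sum (s := Finset.range n)]
  · rw [Finset.sum_congr rfl fun k hk => if_pos (Finset.mem_range.1 hk)]
    simp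
  · exact fun k hk => if_neg fun hk' => hk (Finset.mem_range.2 hk')

/-- Optional stopping for a potential `M` that is at least `1` at the leaves and whose expected
value increases by at most `δ` in every step. -/
theorem terminationProb_le_of_potential (M : List ℕ → ℝ≥0∞) (δ : ℝ≥0∞)
    (hleaf : ∀ v ∈ T.leaves, 1 ≤ M v)
    (hinner : ∀ v ∈ T.nodes, 0 < T.numChildren v →
      ∑ i ∈ Finset.range (T.numChildren v), (T.prob (v ++ [i]) : ℝ≥0∞) * M (v ++ [i]) ≤
        T.prob v * (M v + δ)) :
    T.terminationProb ≤ M [] + δ * ∑' n, levelSum T.nodeProb (n + 1) := by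
  set G : List ℕ → ℝ≥0∞ := T.nodes.indicator fun v => (T.prob v : ℝ≥0∞) * M v with hG
  -- At a leaf this is `1 ≤ M v`; at an inner node it is `hinner`, with the mass of the children
  -- combined into that of `v`. Summed over a level, it telescopes.
  have hpt (v : List ℕ) : T.leafProb v + ∑' i, G (v ++ [i]) ≤
      G v + δ * ∑' i, T.nodeProb (v ++ [i]) := by
    by_cases hv : v ∈ T.nodes
    · rw [hG, nodeProb, T.tsum_indicator_children _ hv, T.tsum_indicator_children _ hv,
        Set.indicator_of_mem hv, leafProb]
      rcases Nat.eq_zero_or_pos (T.numChildren v) with hc | hc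
      · have hl : v ∈ T.leaves := ⟨hv, hc⟩
        rw [Set.indicator_of_mem hl, hc]
        simpa using mul_le_mul_right (hleaf v hl) (T.prob v : ℝ≥0∞)
      · rw [Set.indicator_of_notMem (fun h => hc.ne' h.2), zero_add]
        refine (hinner v hv hc).trans_eq ?_
        rw [← ENNReal.ofNNReal_finsetSum, T.sum_prob_children hv hc]
        ring
    · rw [hG, T.tsum_indicator_children_of_notMem _ hv, leafProb,
        Set.indicator_of_notMem (fun h => hv h.1)]
      simp
  have hlev (n : ℕ) : levelSum T.leafProb n + levelSum G (n + 1) ≤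
      levelSum G n + δ * levelSum T.nodeProb (n + 1) := by
    rw [levelSum_succ, levelSum_succ, ← levelSum_mul_left, ← levelSum_add, ← levelSum_add]
    exact levelSum_mono hpt n
  have hsum (n : ℕ) : ∑ k ∈ Finset.range n, levelSum T.leafProb k + levelSum G n ≤
      M [] + δ * ∑ k ∈ Finset.range n, levelSum T.nodeProb (k + 1) := by
    induction n with
    | zero => simp [levelSum_zero, hG, Set.indicator_of_mem T.root_mem, T.prob_root]
    | succ n ih =>
      calc _ = ∑ k ∈ Finset.range n, levelSum T.leafProb k +
            (levelSum T.leafProb n + levelSum G (n + 1)) := by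
            rw [Finset.sum_range_succ, add_assoc]
        _ ≤ ∑ k ∈ Finset.range n, levelSum T.leafProb k +
            (levelSum G n + δ * levelSum T.nodeProb (n + 1)) := by
            exact add_le_add_right (hlev n) _
        _ = (∑ k ∈ Finset.range n, levelSum T.leafProb k + levelSum G n) +
            δ * levelSum T.nodeProb (n + 1) := by rw [add_assoc]
        _ ≤ M [] + δ * ∑ k ∈ Finset.range n, levelSum T.nodeProb (k + 1) +
            δ * levelSum T.nodeProb (n + 1) := by gcongr
        _ = _ := by rw [Finset.sum_range_succ]; ring
  rw [terminationProb_eq, ← tsum_levelSum]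
  refine ENNReal.tsum_le_of_sum_range_le fun n => ?_
  calc _ ≤ _ := le_self_add
    _ ≤ _ := hsum n
    _ ≤ _ := by gcongr; exact ENNReal.sum_le_tsum _

end RST

end ProbRewriting

namespace ProbRewriting

/-! ### Occurrences of linear terms under rewriting -/

open FirstOrder.Language (Term)

variable {L : FirstOrder.Language} {V : Type*}

/-! ### Subterms and replacement -/

@[simp]
theorem subtermAt_nil (s : L.Term V) : subtermAt s [] = some s := by
  cases s <;> rfl

@[simp]
theorem replaceAt_nil (s r : L.Term V) : replaceAt s [] r = r := by
  cases s <;> rfl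

theorem subtermAt_append (s : L.Term V) (π τ : List ℕ) :
    subtermAt s (π ++ τ) = (subtermAt s π).bind fun u => subtermAt u τ := by
  induction π generalizing s with
  | nil => simp
  | cons i π ih =>
    cases s with
    | var x => simp [subtermAt]
    | func f ts =>
      simp only [List.cons_append, subtermAt]
      split_ifs with h
      · exact ih _
      · rfl

theorem replaceAt_append {s u : L.Term V} {π : List ℕ} (h : subtermAt s π = some u)
    (τ : List ℕ) (r : L.Term V) :
    replaceAt s (π ++ τ) r = replaceAt s π (replaceAt u τ r) := by
  induction π generalizing s with
  | nil => simp_all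
  | cons i π ih =>
    cases s with
    | var x => simp [subtermAt] at h
    | func f ts =>
      simp only [subtermAt] at h
      split_ifs at h with hi
      simp only [List.cons_append, replaceAt, Term.func.injEq, heq_eq_eq, true_and]
      funext j
      split_ifs with hj
      · obtain rfl : j = ⟨i, hi⟩ := Fin.ext hj
        exact ih h
      · rfl

theorem subtermAt_replaceAt_self {s u : L.Term V} {π : List ℕ} (h : subtermAt s π = some u)
    (r : L.Term V) : subtermAt (replaceAt s π r) π = some r := by
  induction π generalizing s with
  | nil => simp
  | cons i π ih =>
    cases s with
    | var x => simp [subtermAt] at h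
    | func f ts =>
      simp only [subtermAt] at h
      split_ifs at h with hi
      simp only [replaceAt, subtermAt, hi, dif_pos, if_pos]
      exact ih h

theorem subtermAt_replaceAt_append {s u : L.Term V} {π : List ℕ} (h : subtermAt s π = some u)
    (τ : List ℕ) (r : L.Term V) :
    subtermAt (replaceAt s (π ++ τ) r) π = some (replaceAt u τ r) := by
  rw [replaceAt_append h]
  exact subtermAt_replaceAt_self h _

theorem subtermAt_replaceAt_of_not_prefix (s r : L.Term V) {π π' : List ℕ} (h : ¬ π <+: π')
    (h' : ¬ π' <+: π) : subtermAt (replaceAt s π r) π' = subtermAt s π' := by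
  induction π generalizing s π' with
  | nil => exact absurd List.nil_prefix h
  | cons i π ih =>
    cases π' with
    | nil => exact absurd List.nil_prefix h'
    | cons j π' =>
      cases s with
      | var x => rfl
      | func f ts =>
        simp only [replaceAt, subtermAt]
        split_ifs with hj hij
        · subst hij
          exact ih _ (fun hp => h (by simpa using hp)) (fun hp => h' (by simpa using hp))
        · rfl
        · rfl

/-! ### Substitutions, and replacement below a variable -/

namespace Subst

theorem apply_var (σ : Subst L V) (x : V) : σ.apply (.var x) = σ.toFun x := rfl

theorem apply_func (σ : Subst L V) {n : ℕ} (f : L.Functions n) (ts : Fin n → L.Term V) :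
    σ.apply (.func f ts) = .func f fun j => σ.apply (ts j) := rfl

/-- The identity substitution. -/
def id : Subst L V := ⟨Term.var, by simp⟩

theorem id_apply (t : L.Term V) : (id : Subst L V).apply t = t := by
  induction t with
  | var x => rfl
  | func f ts ih => rw [apply_func]; exact congrArg _ (funext ih)

/-- Composition of substitutions: first `τ`, then `σ`. -/
def comp (σ τ : Subst L V) : Subst L V where
  toFun x := σ.apply (τ.toFun x)
  finite_dom := by
    refine (σ.finite_dom.union τ.finite_dom).subset fun x hx => ?_
    by_contra hn
    simp only [Set.mem_union, Set.mem_ofPred_eq, not_or, not_not] at hn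
    exact hx (by rw [hn.2, apply_var, hn.1])

theorem comp_apply (σ τ : Subst L V) (t : L.Term V) :
    (σ.comp τ).apply t = σ.apply (τ.apply t) := by
  induction t with
  | var x => rfl
  | func f ts ih => simp only [apply_func, ih]

open Classical in
/-- The substitution that maps `x` to `u` and agrees with `σ` elsewhere. -/
noncomputable def update (σ : Subst L V) (x : V) (u : L.Term V) : Subst L V where
  toFun := Function.update σ.toFun x u
  finite_dom := by
    refine (σ.finite_dom.union (Set.finite_singleton x)).subset fun y hy => ?_
    by_cases hyx : y = x
    · exact Or.inr hyx
    · exact Or.inl (by simpa [Function.update_of_ne hyx] using hy)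

theorem update_apply_of_not_occurs (σ : Subst L V) (x : V) (u t : L.Term V)
    (h : ∀ α, subtermAt t α ≠ some (.var x)) : (σ.update x u).apply t = σ.apply t := by
  induction t with
  | var y =>
    have hyx : y ≠ x := by
      rintro rfl
      exact h [] (subtermAt_nil _)
    classical exact Function.update_of_ne hyx u σ.toFun
  | func f ts ih =>
    simp only [apply_func, Term.func.injEq, heq_eq_eq, true_and]
    funext j
    exact ih j fun α hα => h (j :: α) (by simpa [subtermAt] using hα)

theorem subtermAt_apply (σ : Subst L V) {t u : L.Term V} {π : List ℕ}
    (h : subtermAt t π = some u) : subtermAt (σ.apply t) π = some (σ.apply u) := by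
  induction π generalizing t with
  | nil => simp_all
  | cons i π ih =>
    cases t with
    | var x => simp [subtermAt] at h
    | func f ts =>
      simp only [subtermAt] at h
      split_ifs at h with hi
      simp only [apply_func, subtermAt, hi, dif_pos]
      exact ih h

theorem apply_replaceAt (σ : Subst L V) {t u : L.Term V} {π : List ℕ}
    (h : subtermAt t π = some u) (r : L.Term V) :
    σ.apply (replaceAt t π r) = replaceAt (σ.apply t) π (σ.apply r) := by
  induction π generalizing t with
  | nil => simp
  | cons i π ih =>
    cases t with
    | var x => simp [subtermAt] at h
    | func f ts =>
      simp only [subtermAt] at h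
      split_ifs at h with hi
      simp only [apply_func, replaceAt, Term.func.injEq, heq_eq_eq, true_and]
      funext j
      split_ifs with hj
      · obtain rfl : j = ⟨i, hi⟩ := Fin.ext hj
        exact ih h
      · rfl

/-- A position of `tσ` that is not a function position of `t` lies below a variable of `t`. -/
theorem exists_var_position (σ : Subst L V) {t : L.Term V} {τ : List ℕ}
    (hτ : τ ∈ Pos (σ.apply t)) (hτ' : τ ∉ PosFun t) :
    ∃ α β x, τ = α ++ β ∧ subtermAt t α = some (.var x) := by
  induction t generalizing τ with
  | var x => exact ⟨[], τ, x, rfl, subtermAt_nil _⟩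
  | func f ts ih =>
    cases τ with
    | nil => exact absurd ⟨_, f, ts, subtermAt_nil _⟩ hτ'
    | cons i τ =>
      obtain ⟨s, hs⟩ := hτ
      simp only [apply_func, subtermAt] at hs
      split_ifs at hs with hi
      obtain ⟨α, β, x, rfl, hα⟩ := ih ⟨i, hi⟩ ⟨s, hs⟩ (τ := τ) (by
        rintro ⟨m, g, us, hu⟩
        exact hτ' ⟨m, g, us, by simpa [subtermAt, hi] using hu⟩)
      exact ⟨i :: α, β, x, rfl, by simpa [subtermAt, hi] using hα⟩

/-- The change happens inside the image of `x`, so it can be absorbed into the substitution. As `x`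
occurs nowhere else, the rest of the instance is not affected by the update. -/
theorem replaceAt_apply_of_unique (σ : Subst L V) {t : L.Term V} {α : List ℕ} {x : V}
    (hα : subtermAt t α = some (.var x))
    (huniq : ∀ α', subtermAt t α' = some (.var x) → α' = α) (β : List ℕ) (r : L.Term V) :
    replaceAt (σ.apply t) (α ++ β) r = (σ.update x (replaceAt (σ.toFun x) β r)).apply t := by
  induction t generalizing α with
  | var y =>
    obtain rfl : [] = α := by
      cases α with
      | nil => rfl
      | cons i α => simp [subtermAt] at hα
    obtain rfl : y = x := by simpa using hα
    simp [apply_var, update]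
  | func f ts ih =>
    cases α with
    | nil => simp at hα
    | cons i α =>
      simp only [subtermAt] at hα
      split_ifs at hα with hi
      simp only [List.cons_append, apply_func, replaceAt, Term.func.injEq, heq_eq_eq, true_and]
      funext j
      split_ifs with hj
      · obtain rfl : j = ⟨i, hi⟩ := Fin.ext hj
        refine ih _ hα fun α' hα' => ?_
        simpa using huniq (i :: α') (by simpa [subtermAt, hi] using hα')
      · refine (update_apply_of_not_occurs σ x _ _ fun α' hα' => hj ?_).symm
        have := huniq (j :: α') (by simpa [subtermAt] using hα')
        simp only [List.cons.injEq] at this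
        exact this.1

/-- Replacing a subterm of an instance of a linear term `t` that is not at a function position
of `t` yields an instance of `t` again. -/
theorem exists_replaceAt_eq_apply (σ : Subst L V) {t : L.Term V} (ht : IsLinear t) {τ : List ℕ}
    (hτ : τ ∈ Pos (σ.apply t)) (hτ' : τ ∉ PosFun t) (r : L.Term V) :
    ∃ σ' : Subst L V, replaceAt (σ.apply t) τ r = σ'.apply t := by
  obtain ⟨α, β, x, rfl, hα⟩ := σ.exists_var_position hτ hτ'
  exact ⟨_, σ.replaceAt_apply_of_unique hα
    (fun α' hα' => Set.encard_le_one_iff.1 (ht x) _ _ hα' hα) β r⟩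

end Subst

/-! ### Occurrences, overlaps and the focus invariant -/

theorem posFun_of_append {t : L.Term V} {α β : List ℕ} (h : α ++ β ∈ PosFun t) (hβ : β ≠ []) :
    α ∈ PosFun t := by
  obtain ⟨n, f, ts, h⟩ := h
  rw [subtermAt_append] at h
  obtain ⟨u, hu, hu'⟩ := Option.bind_eq_some_iff.1 h
  cases u with
  | var x =>
    cases β with
    | nil => exact absurd rfl hβ
    | cons i β => simp [subtermAt] at hu'
  | func g us => exact ⟨_, g, us, hu⟩

theorem OccursAt.append {t s u : L.Term V} {π γ : List ℕ} {σ : Subst L V}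
    (hπ : subtermAt s π = some (σ.apply u)) (h : OccursAt t u γ) : OccursAt t s (π ++ γ) := by
  obtain ⟨σ', h⟩ := h
  refine ⟨σ.comp σ', ?_⟩
  rw [subtermAt_append, hπ, Subst.comp_apply]
  exact σ.subtermAt_apply h

/-- Occurrences of a linear term survive rewrite steps that are not at or above them and that do
not overlap with them. -/
theorem OccursAt.replaceAt {t s u : L.Term V} {π π' : List ℕ} (h : OccursAt t s π')
    (ht : IsLinear t) (hπ : subtermAt s π = some u) (hpre : ¬ π <+: π')
    (hov : ¬ Overlapping t π π') (r : L.Term V) : OccursAt t (replaceAt s π r) π' := by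
  obtain ⟨σ, h⟩ := h
  by_cases hp : π' <+: π
  · obtain ⟨τ, rfl⟩ := hp
    obtain ⟨σ', h'⟩ := σ.exists_replaceAt_eq_apply ht (τ := τ)
      ⟨u, by simpa [subtermAt_append, h] using hπ⟩ (fun hτ => hov ⟨τ, hτ, Or.inl rfl⟩) r
    exact ⟨σ', by rw [subtermAt_replaceAt_append h, h']⟩
  · exact ⟨σ, by rw [subtermAt_replaceAt_of_not_prefix _ _ hpre hp, h]⟩

theorem Overlapping.symm {t : L.Term V} {π π' : List ℕ} (h : Overlapping t π π') :
    Overlapping t π' π := by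
  obtain ⟨τ, hτ, h⟩ := h
  exact ⟨τ, hτ, h.symm⟩

theorem overlapping_append_iff {t : L.Term V} {π γ γ' : List ℕ} :
    Overlapping t (π ++ γ) (π ++ γ') ↔ Overlapping t γ γ' := by
  simp [Overlapping, List.append_assoc]

/-- Occurrences found inside the focus thus cannot overlap with pending ones. As `π'` is not at or
below `π`, it must be a proper prefix of `π`, and the remainder is a prefix of a function position
of `t`. -/
theorem Overlapping.of_append {t : L.Term V} {π π' γ : List ℕ} (hpre : ¬ π <+: π')
    (h : Overlapping t (π ++ γ) π') : Overlapping t π π' := by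
  obtain ⟨τ, hτ, h | h⟩ := h
  · rcases List.append_eq_append_iff.1 h with ⟨as, rfl, -⟩ | ⟨bs, rfl, rfl⟩
    · exact absurd (List.prefix_append _ _) hpre
    · refine ⟨bs, ?_, Or.inl rfl⟩
      by_cases hγ : γ = []
      · simpa [hγ] using hτ
      · exact posFun_of_append hτ hγ
  · exact absurd ⟨γ ++ τ, by simp [h]⟩ hpre

/-- The term `s` consists of an instance of `u` at some position and `k` further occurrences of `t`
that are not below that position, all of them non-overlapping. -/
def Focused (t u : L.Term V) (k : ℕ) (s : L.Term V) : Prop :=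
  ∃ (S : Finset (List ℕ)) (π : List ℕ) (σ : Subst L V), S.card = k ∧
    subtermAt s π = some (σ.apply u) ∧ S ∈ NO t s ∧
    ∀ π' ∈ S, ¬ π <+: π' ∧ ¬ Overlapping t π π'

theorem focused_self (t : L.Term V) : Focused t t 0 t :=
  ⟨∅, [], Subst.id, rfl, by simp [Subst.id_apply], by simp [NO], by simp⟩

/-- The focus of `s` may be moved to one of the pending occurrences. -/
theorem Focused.restart {t u s : L.Term V} {k : ℕ} (h : Focused t u k s)
    (hpos : 0 < k + maxNO t u) : ∃ k', k' + 1 = k + maxNO t u ∧ Focused t t k' s := by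
  classical
  obtain ⟨S, π, σ, rfl, hπ, ⟨-, hS, hSS⟩, hpre⟩ := h
  obtain ⟨S₁, ⟨-, hS₁, hSS₁⟩, hcard⟩ := (isGreatest_maxNO t u).1
  set S' : Finset (List ℕ) := S ∪ S₁.image (π ++ ·) with hS'
  have hdisj : Disjoint S (S₁.image (π ++ ·)) := by
    rw [Finset.disjoint_left]
    rintro π' h1 h2
    obtain ⟨γ, -, rfl⟩ := Finset.mem_image.1 h2
    exact (hpre _ h1).1 (List.prefix_append _ _)
  have hcard' : S'.card = S.card + maxNO t u := by
    rw [hS', Finset.card_union_of_disjoint hdisj,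
      Finset.card_image_of_injective _ (List.append_right_injective π), hcard]
  have hocc : ∀ π' ∈ S', OccursAt t s π' := by
    intro π' h'
    rcases Finset.mem_union.1 h' with h' | h'
    · exact hS _ h'
    · obtain ⟨γ, hγ, rfl⟩ := Finset.mem_image.1 h'
      exact (hS₁ γ hγ).append hπ
  have hno : ∀ π₁ ∈ S', ∀ π₂ ∈ S', π₁ ≠ π₂ → ¬ Overlapping t π₁ π₂ := by
    intro π₁ h1 π₂ h2 hne
    rcases Finset.mem_union.1 h1 with h1 | h1 <;> rcases Finset.mem_union.1 h2 with h2 | h2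
    · exact hSS _ h1 _ h2 hne
    · obtain ⟨γ, -, rfl⟩ := Finset.mem_image.1 h2
      exact fun ho => (hpre _ h1).2 (ho.symm.of_append (hpre _ h1).1)
    · obtain ⟨γ, -, rfl⟩ := Finset.mem_image.1 h1
      exact fun ho => (hpre _ h2).2 (ho.of_append (hpre _ h2).1)
    · obtain ⟨γ, hγ, rfl⟩ := Finset.mem_image.1 h1
      obtain ⟨γ', hγ', rfl⟩ := Finset.mem_image.1 h2
      rw [overlapping_append_iff]
      exact hSS₁ _ hγ _ hγ' fun h => hne (by rw [h])
  -- A longest position is chosen, so that no other pending occurrence lies below the new focus.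
  obtain ⟨π₀, hπ₀, hmax⟩ := S'.exists_max_image List.length (Finset.card_pos.1 (hcard' ▸ hpos))
  obtain ⟨σ₀, hσ₀⟩ := hocc π₀ hπ₀
  refine ⟨(S'.erase π₀).card, ?_, S'.erase π₀, π₀, σ₀, rfl, hσ₀, ⟨?_, ?_, ?_⟩, ?_⟩
  · rw [Finset.card_erase_add_one hπ₀, hcard']
  · intro π' h'
    obtain ⟨σ', h⟩ := hocc π' (Finset.mem_of_mem_erase h')
    exact ⟨_, h⟩
  · exact fun π' h' => hocc π' (Finset.mem_of_mem_erase h')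
  · exact fun π₁ h1 π₂ h2 => hno _ (Finset.mem_of_mem_erase h1) _ (Finset.mem_of_mem_erase h2)
  · intro π' h'
    have hm := Finset.mem_of_mem_erase h'
    have hne := Finset.ne_of_mem_erase h'
    exact ⟨fun hp => hne (hp.eq_of_length_le (hmax _ hm)).symm, hno _ hπ₀ _ hm hne.symm⟩

/-- A rewrite step of `u` can be performed at the focus of `s`. -/
theorem Focused.step {P : PTRS L V} {t u s : L.Term V} {k : ℕ} (ht : IsLinear t)
    (h : Focused t u k s) :
    ∃ F : L.Term V → L.Term V, (∀ u', Focused t u' k (F u')) ∧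
      ∀ μ, P.Step u μ → ∃ μ', P.Step s μ' ∧ μ'.entries = μ.entries.map fun q => (q.1, F q.2) := by
  obtain ⟨S, π, σ, hk, hπ, ⟨-, hS, hSS⟩, hpre⟩ := h
  have hocc (u' : L.Term V) : ∀ π' ∈ S, OccursAt t (replaceAt s π (σ.apply u')) π' :=
    fun π' h' => (hS π' h').replaceAt ht hπ (hpre _ h').1 (hpre _ h').2 _
  refine ⟨fun u' => replaceAt s π (σ.apply u'), fun u' =>
    ⟨S, π, σ, hk, subtermAt_replaceAt_self hπ _, ⟨?_, hocc u', hSS⟩, hpre⟩, ?_⟩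
  · intro π' h'
    obtain ⟨σ', h⟩ := hocc u' π' h'
    exact ⟨_, h⟩
  · rintro μ ⟨ρ, hρ, π₀, σ₀, hπ₀, hμ⟩
    refine ⟨⟨μ.entries.map fun q => (q.1, replaceAt s π (σ.apply q.2)), ?_, ?_, ?_⟩,
      ⟨ρ, hρ, π ++ π₀, σ.comp σ₀, ?_, ?_⟩, rfl⟩
    · intro q hq
      obtain ⟨q', hq', rfl⟩ := Multiset.mem_map.1 hq
      exact μ.prob_pos q' hq'
    · intro q hq
      obtain ⟨q', hq', rfl⟩ := Multiset.mem_map.1 hq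
      exact μ.prob_le_one q' hq'
    · rw [Multiset.map_map]
      exact μ.prob_sum
    · rw [subtermAt_append, hπ, Subst.comp_apply]
      exact σ.subtermAt_apply hπ₀
    · change μ.entries.map _ = _
      rw [hμ, Multiset.map_map]
      refine Multiset.map_congr rfl fun q _ => ?_
      simp only [Function.comp_apply]
      rw [replaceAt_append hπ, σ.apply_replaceAt hπ₀, Subst.comp_apply]

end ProbRewriting

namespace ProbRewriting

/-! ### Unfolding a probabilistic process into a rewrite sequence tree -/

/-- A process that performs steps of `R`: a state `b` has the `arity b` successors `child b i`,
reached with probability `weight b i`. -/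
structure StochProc {A : Type*} (R : PARS A) (B : Type*) where
  obj : B → A
  arity : B → ℕ
  child : B → ℕ → B
  weight : B → ℕ → ℝ≥0
  step : ∀ b, 0 < arity b → ∃ μ : FDist A, R (obj b) μ ∧
    μ.entries = (Multiset.range (arity b)).map fun i => (weight b i, obj (child b i))

namespace StochProc

variable {A B : Type*} {R : PARS A} (p : StochProc R B)

/-- The state reached from `b` along an address. -/
def stateAt (b : B) (v : List ℕ) : B := v.foldl p.child b

/-- The addresses that respect the arities of the states. -/
def Valid (b : B) : List ℕ → Prop
  | [] => True
  | i :: v => i < p.arity b ∧ Valid (p.child b i) v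

/-- The probability of following an address. -/
noncomputable def pathProb (b : B) : List ℕ → ℝ≥0
  | [] => 1
  | i :: v => p.weight b i * pathProb (p.child b i) v

theorem stateAt_concat (b : B) (v : List ℕ) (i : ℕ) :
    p.stateAt b (v ++ [i]) = p.child (p.stateAt b v) i := by
  simp [stateAt]

theorem valid_concat (b : B) (v : List ℕ) (i : ℕ) :
    p.Valid b (v ++ [i]) ↔ p.Valid b v ∧ i < p.arity (p.stateAt b v) := by
  induction v generalizing b with
  | nil => simp [Valid, stateAt]
  | cons j v ih =>
    simp only [List.cons_append, Valid, ih, and_assoc]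
    rfl

theorem pathProb_concat (b : B) (v : List ℕ) (i : ℕ) :
    p.pathProb b (v ++ [i]) = p.pathProb b v * p.weight (p.stateAt b v) i := by
  induction v generalizing b with
  | nil => simp [pathProb, stateAt]
  | cons j v ih =>
    simp only [List.cons_append, pathProb, ih, mul_assoc]
    rfl

theorem weight_pos_le_one {b : B} {i : ℕ} (hi : i < p.arity b) :
    0 < p.weight b i ∧ p.weight b i ≤ 1 := by
  obtain ⟨μ, -, hμ⟩ := p.step b (by omega)
  have hmem : (p.weight b i, p.obj (p.child b i)) ∈ μ.entries := by
    rw [hμ]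
    exact Multiset.mem_map.2 ⟨i, Multiset.mem_range.2 hi, rfl⟩
  exact ⟨μ.prob_pos _ hmem, μ.prob_le_one _ hmem⟩

theorem pathProb_pos_le_one {b : B} {v : List ℕ} (h : p.Valid b v) :
    0 < p.pathProb b v ∧ p.pathProb b v ≤ 1 := by
  induction v generalizing b with
  | nil => simp [pathProb]
  | cons i v ih =>
    obtain ⟨hi, hv⟩ := h
    have h1 := p.weight_pos_le_one hi
    have h2 := ih hv
    exact ⟨mul_pos h1.1 h2.1, mul_le_one' h1.2 h2.2⟩

/-- The rewrite sequence tree of all runs of the process from the state `b`. -/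
noncomputable def unfold (b : B) : RST R where
  nodes := {v | p.Valid b v}
  numChildren v := p.arity (p.stateAt b v)
  prob := p.pathProb b
  obj v := p.obj (p.stateAt b v)
  root_mem := trivial
  child_mem_iff := p.valid_concat b
  prob_root := rfl
  prob_pos _ hv := (p.pathProb_pos_le_one hv).1
  prob_le_one _ hv := (p.pathProb_pos_le_one hv).2
  step v hv hc := by
    obtain ⟨μ, hR, hμ⟩ := p.step _ hc
    refine ⟨μ, hR, ?_⟩
    rw [hμ]
    refine Multiset.map_congr rfl fun i _ => ?_
    rw [pathProb_concat, mul_div_cancel_left₀ _ (p.pathProb_pos_le_one hv).1.ne', stateAt_concat]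

/-- Optional stopping for a potential on the states of a process. -/
theorem terminationProb_unfold_le (b : B) (M : B → ℝ≥0∞) (δ : ℝ≥0∞)
    (hleaf : ∀ b, p.arity b = 0 → 1 ≤ M b)
    (hinner : ∀ b, 0 < p.arity b →
      ∑ i ∈ Finset.range (p.arity b), (p.weight b i : ℝ≥0∞) * M (p.child b i) ≤ M b + δ) :
    (p.unfold b).terminationProb ≤
      M b + δ * ∑' n, levelSum (p.unfold b).nodeProb (n + 1) := by
  refine (p.unfold b).terminationProb_le_of_potential (fun v => M (p.stateAt b v)) δ
    (fun v hv => hleaf _ hv.2) fun v _ hc => ?_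
  refine le_trans (le_of_eq ?_) (mul_le_mul_right (hinner _ hc) _)
  rw [Finset.mul_sum]
  refine Finset.sum_congr rfl fun i _ => ?_
  change (p.pathProb b (v ++ [i]) : ℝ≥0∞) * M (p.stateAt b (v ++ [i])) =
    p.pathProb b v * (p.weight (p.stateAt b v) i * M (p.child (p.stateAt b v) i))
  rw [pathProb_concat, stateAt_concat, ENNReal.coe_mul, mul_assoc]

end StochProc

/-! ### Repeating a rewrite sequence tree -/

namespace RST

variable {A : Type*} {R : PARS A} (T : RST R)

theorem numChildren_nil_pos (h : 0 < T.height) : 0 < T.numChildren [] := by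
  obtain ⟨v, hv⟩ := lt_iSup_iff.1 h
  obtain ⟨hmem, hd⟩ := lt_iSup_iff.1 hv
  have hne : v ≠ [] := by
    rintro rfl
    simp [depth] at hd
  clear hd hv
  induction v using List.reverseRecOn with
  | nil => exact absurd rfl hne
  | append_singleton v i ih =>
    obtain ⟨hv, hi⟩ := (T.child_mem_iff v i).1 hmem
    by_cases h0 : v = []
    · subst h0
      omega
    · exact ih hv h0

/-- The sum of `F` over the leaves below `v`. -/
noncomputable def leafSum (F : List ℕ → ℝ≥0∞) (v : List ℕ) : ℝ≥0∞ :=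
  ∑' u, T.leaves.indicator F (v ++ u)

theorem leafSum_nil (F : List ℕ → ℝ≥0∞) : T.leafSum F [] = ∑' v : T.leaves, F v :=
  (tsum_subtype T.leaves F).symm

theorem mem_nodes_of_append {v u : List ℕ} (h : v ++ u ∈ T.nodes) : v ∈ T.nodes := by
  induction u using List.reverseRecOn with
  | nil => simpa using h
  | append_singleton u i ih =>
    rw [← List.append_assoc] at h
    exact ih ((T.child_mem_iff _ _).1 h).1

theorem leafSum_eq_of_numChildren_eq_zero (F : List ℕ → ℝ≥0∞) {v : List ℕ} (hv : v ∈ T.nodes)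
    (hc : T.numChildren v = 0) : T.leafSum F v = F v := by
  rw [leafSum, tsum_eq_single [], List.append_nil, Set.indicator_of_mem (s := T.leaves) ⟨hv, hc⟩]
  rintro (_ | ⟨i, u⟩) hu
  · exact absurd rfl hu
  · refine Set.indicator_of_notMem (fun h => ?_) _
    have h' : v ++ [i] ∈ T.nodes := T.mem_nodes_of_append (u := u) (by simpa using h.1)
    have := ((T.child_mem_iff v i).1 h').2
    omega

/-- Every leaf below an inner node lies below exactly one child. This is the martingale property
behind the potential in `exists_repeat`. -/
theorem sum_leafSum_children (F : List ℕ → ℝ≥0∞) {v : List ℕ} (hc : 0 < T.numChildren v) :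
    ∑ i ∈ Finset.range (T.numChildren v), T.leafSum F (v ++ [i]) = T.leafSum F v := by
  conv_rhs => rw [leafSum, tsum_list_cons, List.append_nil,
    Set.indicator_of_notMem (fun h => hc.ne' h.2), zero_add]
  rw [tsum_eq_sum (s := Finset.range (T.numChildren v))]
  · simp [leafSum]
  · refine fun i hi => ENNReal.tsum_eq_zero.2 fun u => Set.indicator_of_notMem (fun h => hi ?_) _
    have h' : v ++ [i] ∈ T.nodes := T.mem_nodes_of_append (u := u) (by simpa using h.1)
    exact Finset.mem_range.2 ((T.child_mem_iff v i).1 h').2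

/-- `Inv v k a` says that the object `a` is in the course of a run of `T` that has reached the node
`v`, while `k` further runs are pending.  If `Inv` can be followed along steps, and if at a leaf `v`
there are `X v` new pending runs, one of which can be started if there is any, then there is a
rewrite sequence tree that repeats `T` until no run is pending. -/
theorem exists_repeat (X : List ℕ → ℕ) (Inv : List ℕ → ℕ → A → Prop) {a₀ : A}
    (hroot : 0 < T.numChildren []) (hinit : Inv [] 0 a₀)
    (hstep : ∀ v k a, v ∈ T.nodes → 0 < T.numChildren v → Inv v k a → ∃ g : ℕ → A,
      (∀ i, Inv (v ++ [i]) k (g i)) ∧ ∃ μ : FDist A, R a μ ∧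
        μ.entries = (Multiset.range (T.numChildren v)).map
          fun i => (T.prob (v ++ [i]) / T.prob v, g i))
    (hrestart : ∀ v k a, v ∈ T.leaves → Inv v k a → 0 < k + X v →
      ∃ k', k' + 1 = k + X v ∧ Inv [] k' a) :
    ∃ T' : RST R, ∀ ρ δ : ℝ≥0, ρ ≤ 1 →
      ∑' v : T.leaves, (T.prob v : ℝ≥0∞) * (ρ : ℝ≥0∞) ^ X v ≤ ρ + δ →
      T'.terminationProb ≤ ∑' v : T.leaves, (T.prob v : ℝ≥0∞) * (ρ : ℝ≥0∞) ^ X v +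
        δ * ∑' n, levelSum T'.nodeProb (n + 1) := by
  classical
  let B := {b : List ℕ × ℕ × A // b.1 ∈ T.nodes ∧ Inv b.1 b.2.1 b.2.2}
  -- Restarting is not a rewrite step: it replaces the bookkeeping `(v, k)` at a leaf by `([], k')`
  -- and keeps the object. Since the root has children, a restarted state always has a step to
  -- perform; a state without one has reached a leaf with nothing pending.
  have hready (b : B) : ∃ c : B, c.1.2.2 = b.1.2.2 ∧
      ((T.numChildren c.1.1 = 0 ∧ b = c ∧ b.1.2.1 + X b.1.1 = 0) ∨
        (0 < T.numChildren c.1.1 ∧ (b = c ∨ (T.numChildren b.1.1 = 0 ∧ c.1.1 = [] ∧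
          c.1.2.1 + 1 = b.1.2.1 + X b.1.1)))) := by
    obtain ⟨⟨v, k, a⟩, hv, hI⟩ := b
    rcases Nat.eq_zero_or_pos (T.numChildren v) with hc | hc
    · rcases Nat.eq_zero_or_pos (k + X v) with hk | hk
      · exact ⟨⟨⟨v, k, a⟩, hv, hI⟩, rfl, Or.inl ⟨hc, rfl, hk⟩⟩
      · obtain ⟨k', hk', hI'⟩ := hrestart v k a ⟨hv, hc⟩ hI hk
        exact ⟨⟨⟨[], k', a⟩, T.root_mem, hI'⟩, rfl, Or.inr ⟨hroot, Or.inr ⟨hc, rfl, hk'⟩⟩⟩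
    · exact ⟨⟨⟨v, k, a⟩, hv, hI⟩, rfl, Or.inr ⟨hc, Or.inl rfl⟩⟩
  choose ready hobj hready using hready
  have hchild (b : B) : ∃ g : ℕ → B, 0 < T.numChildren b.1.1 →
      (∀ i < T.numChildren b.1.1, (g i).1.1 = b.1.1 ++ [i] ∧ (g i).1.2.1 = b.1.2.1) ∧
        ∃ μ : FDist A, R b.1.2.2 μ ∧
          μ.entries = (Multiset.range (T.numChildren b.1.1)).map
            fun i => (T.prob (b.1.1 ++ [i]) / T.prob b.1.1, (g i).1.2.2) := by
    obtain ⟨⟨v, k, a⟩, hv, hI⟩ := b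
    by_cases hc : 0 < T.numChildren v
    · obtain ⟨g, hg, μ, hR, hμ⟩ := hstep v k a hv hc hI
      -- Successors beyond the arity are irrelevant; the state itself serves as default.
      refine ⟨fun i => if hi : i < T.numChildren v then
        ⟨⟨v ++ [i], k, g i⟩, (T.child_mem_iff v i).2 ⟨hv, hi⟩, hg i⟩ else ⟨⟨v, k, a⟩, hv, hI⟩,
        fun _ => ⟨fun i hi => ?_, μ, hR, ?_⟩⟩
      · simp only [dif_pos hi, and_self]
      · rw [hμ]
        refine Multiset.map_congr rfl fun i hi => ?_
        simp only [dif_pos (Multiset.mem_range.1 hi)]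
    · exact ⟨fun _ => ⟨⟨v, k, a⟩, hv, hI⟩, fun h => absurd h hc⟩
  choose next hnext using hchild
  let p : StochProc R B :=
    { obj := fun b => b.1.2.2
      arity := fun b => T.numChildren (ready b).1.1
      child := fun b => next (ready b)
      weight := fun b i => T.prob ((ready b).1.1 ++ [i]) / T.prob (ready b).1.1
      step := fun b hb => hobj b ▸ (hnext (ready b) hb).2 }
  -- The tree is fixed before `ρ` and `δ`, which may therefore depend on its expected derivation
  -- length.
  refine ⟨p.unfold ⟨⟨[], 0, a₀⟩, T.root_mem, hinit⟩, fun ρ δ hρ hf => ?_⟩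
  set F : List ℕ → ℝ≥0∞ := fun v => (T.prob v : ℝ≥0∞) * (ρ : ℝ≥0∞) ^ X v with hF
  have hρ' : (ρ : ℝ≥0∞) ≤ 1 := by exact_mod_cast hρ
  -- The conditional expectation, given the node reached, of `ρ` to the number of runs pending when
  -- the current copy of `T` ends.
  let M : B → ℝ≥0∞ := fun b => (ρ : ℝ≥0∞) ^ b.1.2.1 * (T.leafSum F b.1.1 / T.prob b.1.1)
  have hM0 : M ⟨⟨[], 0, a₀⟩, T.root_mem, hinit⟩ =
      ∑' v : T.leaves, (T.prob v : ℝ≥0∞) * (ρ : ℝ≥0∞) ^ X v := by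
    simp [M, leafSum_nil, T.prob_root, hF]
  have hp (b : B) : (T.prob b.1.1 : ℝ≥0∞) ≠ 0 :=
    ENNReal.coe_ne_zero.2 (T.prob_pos _ b.2.1).ne'
  have hMleaf (b : B) (hc : T.numChildren b.1.1 = 0) :
      M b = (ρ : ℝ≥0∞) ^ (b.1.2.1 + X b.1.1) := by
    simp only [M]
    rw [T.leafSum_eq_of_numChildren_eq_zero F b.2.1 hc, hF, pow_add]
    simp only
    rw [mul_comm (T.prob b.1.1 : ℝ≥0∞), ENNReal.mul_div_cancel_right (hp b) ENNReal.coe_ne_top]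
  -- Only a restart costs `δ`: `ρ ^ (k' + 1)` becomes at most `ρ ^ k' * (ρ + δ)`, and `ρ ^ k' ≤ 1`.
  have hMready (b : B) : M (ready b) ≤ M b + δ := by
    rcases hready b with ⟨-, h, -⟩ | ⟨-, h | ⟨hc, hnil, hk⟩⟩
    · exact h ▸ le_self_add
    · exact h ▸ le_self_add
    · rw [hMleaf b hc, ← hk]
      simp only [M]
      rw [hnil, leafSum_nil, T.prob_root, ENNReal.coe_one, div_one]
      calc _ ≤ (ρ : ℝ≥0∞) ^ (ready b).1.2.1 * (ρ + δ) := mul_le_mul_right hf _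
        _ = (ρ : ℝ≥0∞) ^ ((ready b).1.2.1 + 1) + (ρ : ℝ≥0∞) ^ (ready b).1.2.1 * δ := by ring
        _ ≤ _ := by
          gcongr
          exact mul_le_of_le_one_left' (pow_le_one' hρ' _)
  rw [← hM0]
  refine p.terminationProb_unfold_le _ M δ (fun b hb => ?_) fun b hb => ?_
  · rcases hready b with ⟨hc, h, hk⟩ | ⟨hc, -⟩
    · rw [hMleaf b (by rw [h]; exact hc), hk, pow_zero]
    · exact absurd hb hc.ne'
  · refine le_trans (le_of_eq ?_) (hMready b)
    set c := ready b with hc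
    have hb' : 0 < T.numChildren c.1.1 := hb
    have hg := (hnext c hb').1
    calc _ = ∑ i ∈ Finset.range (T.numChildren c.1.1),
          (ρ : ℝ≥0∞) ^ c.1.2.1 * (T.leafSum F (c.1.1 ++ [i]) / T.prob c.1.1) := by
          refine Finset.sum_congr rfl fun i hi => ?_
          have hi' := Finset.mem_range.1 hi
          have hmem := (T.child_mem_iff _ _).2 ⟨c.2.1, hi'⟩
          have hpi : (T.prob (c.1.1 ++ [i]) : ℝ≥0∞) ≠ 0 :=
            ENNReal.coe_ne_zero.2 (T.prob_pos _ hmem).ne'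
          change ((T.prob (c.1.1 ++ [i]) / T.prob c.1.1 : ℝ≥0) : ℝ≥0∞) *
            ((ρ : ℝ≥0∞) ^ (next c i).1.2.1 *
              (T.leafSum F (next c i).1.1 / T.prob (next c i).1.1)) = _
          rw [(hg i hi').1, (hg i hi').2, ENNReal.coe_div (T.prob_pos _ c.2.1).ne']
          simp only [div_eq_mul_inv]
          calc _ = ((T.prob (c.1.1 ++ [i]) : ℝ≥0∞) * (T.prob (c.1.1 ++ [i]) : ℝ≥0∞)⁻¹) *
                ((ρ : ℝ≥0∞) ^ c.1.2.1 * (T.leafSum F (c.1.1 ++ [i]) *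
                  (T.prob c.1.1 : ℝ≥0∞)⁻¹)) := by ring
            _ = _ := by rw [ENNReal.mul_inv_cancel hpi ENNReal.coe_ne_top, one_mul]
      _ = _ := by
          simp only [M]
          rw [← T.sum_leafSum_children F hb', ← Finset.mul_sum]
          simp only [div_eq_mul_inv, Finset.sum_mul]

/-- The generating function of `X` lies below the line through `(1, 1)` with slope `c` somewhere on
the left of `1` if the expected value of `X` exceeds `c`. -/
theorem exists_generatingFunction_add_le (X : List ℕ → ℕ) (c : ℝ≥0)
    (hc : (c : ℝ≥0∞) < ∑' v : T.leaves, (T.prob v : ℝ≥0∞) * (X v : ℝ≥0∞)) :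
    ∃ ρ r : ℝ≥0, 0 < r ∧ ρ + r = 1 ∧
      ∑' v : T.leaves, (T.prob v : ℝ≥0∞) * (ρ : ℝ≥0∞) ^ X v + c * r ≤ 1 := by
  classical
  -- Finitely many leaves already contribute more than `c`. For these, the difference quotient `(1 -
  -- ρ ^ X) / (1 - ρ)` gives a polynomial `φ` with `φ 1 > c`, so continuity yields a `ρ < 1` with `φ
  -- ρ > c`.
  rw [ENNReal.tsum_eq_iSup_sum] at hc
  obtain ⟨s, hs⟩ := lt_iSup_iff.1 hc
  have hs' : c < ∑ v ∈ s, T.prob v * (X v : ℝ≥0) := by exact_mod_cast hs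
  let φ : ℝ≥0 → ℝ≥0 := fun ρ => ∑ v ∈ s, T.prob v * ∑ i ∈ Finset.range (X v), ρ ^ i
  have hφ : Continuous φ := by fun_prop
  have hφ1 : c < φ 1 := by simpa [φ] using hs'
  have hev : ∀ᶠ ρ in nhdsWithin (1 : ℝ≥0) (Set.Iio 1), c < φ ρ ∧ ρ < 1 :=
    ((hφ.tendsto 1).eventually (lt_mem_nhds hφ1)).filter_mono nhdsWithin_le_nhds |>.and
      self_mem_nhdsWithin
  have : (nhdsWithin (1 : ℝ≥0) (Set.Iio 1)).NeBot :=
    nhdsLT_neBot_of_exists_lt ⟨0, zero_lt_one⟩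
  obtain ⟨ρ, hρ, hρ1⟩ := hev.exists
  obtain ⟨r, hr⟩ := exists_add_of_le hρ1.le
  refine ⟨ρ, r, ?_, hr.symm, ?_⟩
  · refine pos_iff_ne_zero.2 ?_
    rintro rfl
    simp [hr] at hρ1
  have hgeom (n : ℕ) : ρ ^ n + (∑ i ∈ Finset.range n, ρ ^ i) * r = 1 := by
    induction n with
    | zero => simp
    | succ n ih =>
      rw [Finset.sum_range_succ, ← ih]
      calc _ = ρ ^ n * (ρ + r) + (∑ i ∈ Finset.range n, ρ ^ i) * r := by ring
        _ = _ := by rw [← hr, mul_one]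
  have hle : (c : ℝ≥0∞) * r ≤ ∑' v : T.leaves, if v ∈ s then
      ((T.prob v * (∑ i ∈ Finset.range (X v), ρ ^ i) * r : ℝ≥0) : ℝ≥0∞) else 0 := by
    rw [tsum_eq_sum (s := s) (fun v hv => if_neg hv), Finset.sum_congr rfl fun v hv => if_pos hv]
    have h : c * r ≤ φ ρ * r := by gcongr
    simp only [φ, Finset.sum_mul] at h
    exact_mod_cast h
  calc _ ≤ _ := add_le_add_right hle _
    _ = ∑' v : T.leaves, ((T.prob v : ℝ≥0∞) * (ρ : ℝ≥0∞) ^ X v + if v ∈ s then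
      ((T.prob v * (∑ i ∈ Finset.range (X v), ρ ^ i) * r : ℝ≥0) : ℝ≥0∞) else 0) :=
        ENNReal.tsum_add.symm
    _ ≤ ∑' v : T.leaves, (T.prob v : ℝ≥0∞) := by
        refine ENNReal.tsum_le_tsum fun v => ?_
        have h : T.prob v * ρ ^ X v + T.prob v * (∑ i ∈ Finset.range (X v), ρ ^ i) * r =
            T.prob v := by
          rw [mul_assoc, ← mul_add, hgeom, mul_one]
        conv_rhs => rw [← h]
        push_cast
        gcongr
        split_ifs <;> simp
    _ ≤ 1 := T.terminationProb_le_one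

end RST

end ProbRewriting

theorem mainTheorem1 {L : FirstOrder.Language} {V : Type*}
    [Finite (Σ n : ℕ, L.Functions n)] [Infinite V]
    (P : ProbRewriting.PTRS L V) (T : ProbRewriting.RST P.Step) (t : L.Term V)
    (hheight : 0 < T.height) (hroot : T.root = t) (hlinear : ProbRewriting.IsLinear t) :
    (1 < (∑' v : T.leaves, (T.prob v : ℝ≥0∞) * (ProbRewriting.maxNO t (T.obj v) : ℝ≥0∞)) →
      ¬ ProbRewriting.IsAST P.Step) ∧
    (1 ≤ (∑' v : T.leaves, (T.prob v : ℝ≥0∞) * (ProbRewriting.maxNO t (T.obj v) : ℝ≥0∞)) →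
      ¬ ProbRewriting.IsPAST P.Step) := by
  open ProbRewriting in
  have hrep := T.exists_repeat (fun v => maxNO t (T.obj v)) (fun v k a => Focused t (T.obj v) k a)
    (T.numChildren_nil_pos hheight) (a₀ := t)
    (by rw [show T.obj [] = t from hroot]; exact focused_self t)
    (by
      intro v k a hv hc h
      obtain ⟨F, hF, hF'⟩ := h.step (P := P) hlinear
      obtain ⟨μ, hμ, hμe⟩ := T.step v hv hc
      obtain ⟨μ', hμ', hμe'⟩ := hF' μ hμ
      refine ⟨fun i => F (T.obj (v ++ [i])), fun i => hF _, μ', hμ', ?_⟩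
      rw [hμe', hμe, Multiset.map_map]
      rfl)
    (by
      intro v k a _ h hk
      rw [show T.obj [] = t from hroot]
      exact h.restart hk)
  obtain ⟨T', hT'⟩ := hrep
  constructor
  · intro h hAST
    obtain ⟨ρ, r, hr, hρr, hle⟩ := T.exists_generatingFunction_add_le
      (fun v => ProbRewriting.maxNO t (T.obj v)) 1 (by simpa using h)
    have hρ1 : ρ < 1 := hρr ▸ lt_add_of_pos_right ρ hr
    have hf : ∑' v : T.leaves, (T.prob v : ℝ≥0∞) * (ρ : ℝ≥0∞) ^
        ProbRewriting.maxNO t (T.obj v) ≤ ρ := by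
      refine (ENNReal.add_le_add_iff_right (ENNReal.coe_ne_top (r := r))).1 ?_
      rw [← ENNReal.coe_add, hρr]
      simpa using hle
    have := hT' ρ 0 hρ1.le (by simpa using hf)
    rw [hAST T', ENNReal.coe_zero, zero_mul, add_zero] at this
    exact absurd (this.trans hf) (by simpa using hρ1)
  · intro h hPAST
    -- A termination probability below `1` would make the expected derivation length infinite by
    -- definition.
    have hterm : T'.terminationProb = 1 := by
      refine le_antisymm T'.terminationProb_le_one (not_lt.1 fun hlt => ?_)
      simpa [ProbRewriting.RST.edl, hlt] using hPAST T'
    have hedl := hPAST T'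
    rw [ProbRewriting.RST.edl, if_neg (by simp [hterm]), ← T'.tsum_levelSum_nodeProb hterm] at hedl
    lift (∑' n, ProbRewriting.levelSum T'.nodeProb (n + 1)) to ℝ≥0 using hedl.ne with D hD
    have hD2 : D + 2 ≠ 0 := by positivity
    -- The values are chosen such that `c + d = 1`, `c < 1` and `d * D < c`. The first gives `f ≤ ρ
    -- + d * r`; optional stopping then forces `c ≤ d * D`, that is, `D + 1 ≤ D`.
    set d : ℝ≥0 := 1 / (D + 2) with hd
    set c : ℝ≥0 := (D + 1) / (D + 2) with hc
    have hcd : c + d = 1 := by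
      rw [hc, hd, ← add_div, div_eq_one_iff_eq hD2]
      ring
    have hc1 : c < 1 := by
      rw [← hcd]
      exact lt_add_of_pos_right c (by positivity)
    obtain ⟨ρ, r, hr, hρr, hle⟩ := T.exists_generatingFunction_add_le
      (fun v => ProbRewriting.maxNO t (T.obj v)) c
      (lt_of_lt_of_le (by exact_mod_cast hc1) h)
    have hρ1 : ρ ≤ 1 := hρr ▸ le_self_add
    set f := ∑' v : T.leaves, (T.prob v : ℝ≥0∞) * (ρ : ℝ≥0∞) ^
        ProbRewriting.maxNO t (T.obj v) with hf
    have hfle : f ≤ ρ + (d * r : ℝ≥0) := by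
      refine (ENNReal.add_le_add_iff_right (ENNReal.coe_ne_top (r := c * r))).1 ?_
      have : ρ + d * r + c * r = 1 := by
        rw [add_assoc, ← add_mul, add_comm d, hcd, one_mul, hρr]
      rw [← ENNReal.coe_add, ← ENNReal.coe_add, this, ENNReal.coe_mul]
      exact hle
    have hmain := hT' ρ (d * r) hρ1 hfle
    rw [hterm] at hmain
    have hffin : f ≠ ⊤ := ne_top_of_le_ne_top ENNReal.coe_ne_top
      (hfle.trans_eq (ENNReal.coe_add _ _).symm)
    have hcmp : (c * r : ℝ≥0∞) ≤ (d * r : ℝ≥0) * D :=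
      (ENNReal.add_le_add_iff_left hffin).1 (hle.trans hmain)
    have hcmp' : c * r ≤ d * r * D := by exact_mod_cast hcmp
    have hcmp'' : c ≤ d * D := by
      refine le_of_mul_le_mul_right ?_ hr
      calc c * r ≤ _ := hcmp'
        _ = d * D * r := by ring
    rw [hc, hd, div_mul_eq_mul_div, one_mul,
      div_le_div_iff_of_pos_right (pos_iff_ne_zero.2 hD2)] at hcmp''
    exact absurd hcmp'' (not_le.2 (lt_add_one D))
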